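/- Graphs are finite and undirected, with loops and multiple edges allowed. Let $\mathbb F$ be a field and let $\mathcal G$ be the graph algebra over $\mathbb F$: the vector space with basis the isomorphism classes of graphs, with product $G\cdot H=G\uplus H$ (disjoint union), unit the empty graph $K_0$, coproduct $\Delta(G)=\sum_{T\subseteq V(G)}G|_T\otimes G|_{\bar T}$ (where $G|_T$ is the induced subgraph on $T$ and $\bar T=V(G)\setminus T$), and counit $\epsilon(G)=1$ if $G=K_0$ and $\epsilon(G)=0$ otherwise. A character of $\mathcal G$ is a unital algebra homomorphism $\mathcal G\to\mathbb F$; characters are multiplied by convolution, $(\phi*\psi)(G)=\sum_{T\subseteq V(G)}\phi(G|_T)\,\psi(G|_{\bar T})$, with identity $\epsilon$. Let $\Omega$ be a family of graphs closed under isomorphism, and let $\psi_\Omega(G)=1$ if $G\in\Omega$ and $\psi_\Omega(G)=0$ otherwise. 1. The function $\psi_\Omega$ (extended linearly) is a character if and only if $\Omega$ is nonempty and, for all graphs $G$ and $H$, $G\uplus H\in\Omega$ if and only if $G\in\Omega$ and $H\in\Omega$. 2. In this case $\psi_\Omega$ is invertible under convolution, and for every graph $G$ with vertex set $V$ and $n=|V|$,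 $$\psi_\Omega^{-1}(G)=\sum_{\substack{F\in\mathrm{Flat}(G)\\ G_{V,F}\in\Omega}}(-1)^{n-\mathrm{rk}(F)}\,a(G/F).$$ Here an edge set $F\subseteq E(G)$ is a flat if it contains every edge whose endpoints are connected by a path in $F$ (so every flat contains all loops); $\mathrm{Flat}(G)$ is the set of flats of $G$; $\mathrm{rk}(F)$ is the size of any maximal acyclic subset of $F$; $G_{V,F}$ is the subgraph with vertex set $V$ and edge set $F$; $G/F$ is the graph obtained from $G$ by contracting all edges of $F$; and $a(H)$ is the number of acyclic orientations of a graph $H$. -/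

import Mathlib

noncomputable section

open scoped TensorProduct

/-- A finite undirected graph; loops and multiple edges are allowed. Each edge has an unordered
pair of (possibly equal) end vertices. -/
structure Multigraph where
  /-- The vertices. -/
  V : Type
  /-- The edges. -/
  E : Type
  /-- The two ends of an edge. -/
  ends : E → Sym2 V
  [finite_V : Finite V]
  [finite_E : Finite E]

namespace Multigraph

attribute [instance] Multigraph.finite_V Multigraph.finite_E

instance (G : Multigraph) : Fintype G.V := Fintype.ofFinite _

instance (G : Multigraph) : Fintype G.E := Fintype.ofFinite _

/-! ### Isomorphism classes -/

/-- An isomorphism of graphs: bijections on vertices and on edges that respect ends. -/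
structure Iso (G H : Multigraph) where
  onV : G.V ≃ H.V
  onE : G.E ≃ H.E
  ends_onE : ∀ e, H.ends (onE e) = (G.ends e).map onV

instance isoSetoid : Setoid Multigraph where
  r G H := Nonempty (Iso G H)
  iseqv :=
    { refl := fun G => ⟨⟨Equiv.refl _, Equiv.refl _, fun e => by simp⟩⟩
      symm := by
        rintro G H ⟨f⟩
        refine ⟨⟨f.onV.symm, f.onE.symm, fun e => ?_⟩⟩
        have h := f.ends_onE (f.onE.symm e)
        rw [Equiv.apply_symm_apply] at h
        simp [h, Sym2.map_map]
      trans := by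
        rintro G H K ⟨f⟩ ⟨g⟩
        refine ⟨⟨f.onV.trans g.onV, f.onE.trans g.onE, fun e => ?_⟩⟩
        simp [g.ends_onE, f.ends_onE, Sym2.map_map] }

/-! ### Operations on graphs -/

/-- The graph without vertices. -/
def empty : Multigraph where
  V := Empty
  E := Empty
  ends e := e.elim

instance : IsEmpty empty.V := inferInstanceAs (IsEmpty Empty)

/-- The disjoint union of two graphs. -/
def disjUnion (G H : Multigraph) : Multigraph where
  V := G.V ⊕ H.V
  E := G.E ⊕ H.E
  ends := Sum.elim (fun e => (G.ends e).map Sum.inl) (fun e => (H.ends e).map Sum.inr)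

/-- The induced subgraph on a vertex set `T`: its edges are the edges with both ends in `T`. -/
def induce (G : Multigraph) (T : Set G.V) : Multigraph where
  V := {v // v ∈ T}
  E := {e // ∀ v ∈ G.ends e, v ∈ T}
  ends e := (G.ends e.1).attachWith e.2

/-- The subgraph with all the vertices of `G` and with edge set `F`. -/
def spanning (G : Multigraph) (F : Set G.E) : Multigraph where
  V := G.V
  E := {e // e ∈ F}
  ends e := G.ends e.1

/-- `u` and `v` are the two ends of some edge in `F`. -/
def AdjIn (G : Multigraph) (F : Set G.E) (u v : G.V) : Prop :=
  ∃ e ∈ F, G.ends e = s(u, v)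

/-- The contraction of an edge set `F`: the ends of every edge of `F` are identified, and the
edges of `F` are removed. All other edges are kept (possibly as loops or parallel edges).
The quotient `Quot` is by the equivalence relation generated by `G.AdjIn F`. -/
def contract (G : Multigraph) (F : Set G.E) : Multigraph where
  V := Quot (G.AdjIn F)
  E := {e // e ∉ F}
  ends e := (G.ends e.1).map (Quot.mk _)

/-! ### Rank, flats, acyclic orientations -/

/-- `A` contains no cycle. A cycle of length `k + 1` consists of distinct vertices
`v 0, …, v k` and distinct edges `e 0, …, e k` such that `e i` joins `v i` and `v (i + 1)`, the
indices being read modulo `k + 1`; so a loop is a cycle of length one, and two parallel edges form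
a cycle of length two. -/
def IsAcyclic (G : Multigraph) (A : Set G.E) : Prop :=
  ¬ ∃ (k : ℕ) (v : Fin (k + 1) → G.V) (e : Fin (k + 1) → G.E),
    Function.Injective v ∧ Function.Injective e ∧
      ∀ i, e i ∈ A ∧ G.ends (e i) = s(v i, v (i + 1))

/-- The rank of an edge set: the largest size of an acyclic subset. (All maximal acyclic subsets
have the same size; the set of sizes is finite and contains `0`.) -/
def rk (G : Multigraph) (F : Set G.E) : ℕ :=
  sSup {m | ∃ A ⊆ F, G.IsAcyclic A ∧ A.ncard = m}

/-- `F` is a flat: it contains every edge whose ends are connected by a path (of length at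
least zero) in `F`. -/
def IsFlat (G : Multigraph) (F : Set G.E) : Prop :=
  ∀ (e : G.E) (u v : G.V), G.ends e = s(u, v) → Relation.ReflTransGen (G.AdjIn F) u v → e ∈ F

/-- An orientation `o` of `G` turns every edge `e` into an arc from the first to the second
component of `o e`; these are the two ends of `e`. -/
def Orientation (G : Multigraph) : Type :=
  {o : G.E → G.V × G.V // ∀ e, s((o e).1, (o e).2) = G.ends e}

/-- An orientation is acyclic if no nonempty directed walk returns to its starting point. -/
def Orientation.Acyclic {G : Multigraph} (o : G.Orientation) : Prop :=
  ∀ v, ¬ Relation.TransGen (fun u w => ∃ e, o.1 e = (u, w)) v v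

/-- `a(G)`: the number of acyclic orientations of `G`. -/
def numAcyclicOrientations (G : Multigraph) : ℕ :=
  Nat.card {o : G.Orientation // o.Acyclic}

/-! ### Isomorphisms needed for the graph algebra -/

lemma sound {G H : Multigraph} (f : Iso G H) : (⟦G⟧ : Quotient isoSetoid) = ⟦H⟧ :=
  Quotient.sound ⟨f⟩

def Iso.disjUnion {G G' H H' : Multigraph} (f : Iso G G') (g : Iso H H') :
    Iso (G.disjUnion H) (G'.disjUnion H') where
  onV := Equiv.sumCongr f.onV g.onV
  onE := Equiv.sumCongr f.onE g.onE
  ends_onE := by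
    rintro (e | e)
    · change (G'.ends (f.onE e)).map Sum.inl = ((G.ends e).map Sum.inl).map _
      rw [f.ends_onE]
      cases G.ends e with | _ x y => rfl
    · change (H'.ends (g.onE e)).map Sum.inr = ((H.ends e).map Sum.inr).map _
      rw [g.ends_onE]
      cases H.ends e with | _ x y => rfl

def disjUnionAssoc (G H K : Multigraph) :
    Iso ((G.disjUnion H).disjUnion K) (G.disjUnion (H.disjUnion K)) where
  onV := Equiv.sumAssoc _ _ _
  onE := Equiv.sumAssoc _ _ _
  ends_onE := by
    rintro ((e | e) | e)
    · change (G.ends e).map Sum.inl = (((G.ends e).map Sum.inl).map Sum.inl).map _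
      cases G.ends e with | _ x y => rfl
    · change ((H.ends e).map Sum.inl).map Sum.inr = (((H.ends e).map Sum.inr).map Sum.inl).map _
      cases H.ends e with | _ x y => rfl
    · change ((K.ends e).map Sum.inr).map Sum.inr = ((K.ends e).map Sum.inr).map _
      cases K.ends e with | _ x y => rfl

def disjUnionComm (G H : Multigraph) : Iso (G.disjUnion H) (H.disjUnion G) where
  onV := Equiv.sumComm _ _
  onE := Equiv.sumComm _ _
  ends_onE := by
    rintro (e | e)
    · change (G.ends e).map Sum.inr = ((G.ends e).map Sum.inl).map _
      cases G.ends e with | _ x y => rfl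
    · change (H.ends e).map Sum.inl = ((H.ends e).map Sum.inr).map _
      cases H.ends e with | _ x y => rfl

def emptyDisjUnion (G : Multigraph) : Iso (empty.disjUnion G) G where
  onV := Equiv.emptySum Empty _
  onE := Equiv.emptySum Empty _
  ends_onE := by
    rintro (e | e)
    · exact e.elim
    · change G.ends e = ((G.ends e).map Sum.inr).map _
      cases G.ends e with | _ x y => rfl

/-- A graph without vertices has no edges, hence is the empty graph. -/
def isoEmpty (G : Multigraph) [IsEmpty G.V] : Iso G empty where
  onV := Equiv.equivOfIsEmpty _ Empty
  onE := by
    have : IsEmpty G.E := ⟨fun e => isEmptyElim (G.ends e).out.1⟩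
    exact Equiv.equivOfIsEmpty _ Empty
  ends_onE e := isEmptyElim (G.ends e).out.1

lemma map_val_ends_induce (G : Multigraph) (T : Set G.V) (e : (G.induce T).E) :
    ((G.induce T).ends e).map Subtype.val = G.ends e.1 :=
  Sym2.attachWith_map_subtypeVal _

/-- An isomorphism restricts to induced subgraphs. -/
def Iso.induce {G H : Multigraph} (f : Iso G H) (T : Set H.V) :
    Iso (G.induce (f.onV ⁻¹' T)) (H.induce T) where
  onV := f.onV.subtypeEquiv fun _ => Iff.rfl
  onE := f.onE.subtypeEquiv fun e => by
    rw [f.ends_onE]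
    constructor
    · intro h v hv
      obtain ⟨w, hw, rfl⟩ := Sym2.mem_map.1 hv
      exact h w hw
    · intro h v hv
      exact h _ (Sym2.mem_map.2 ⟨v, hv, rfl⟩)
  ends_onE e := by
    apply Sym2.map.injective Subtype.val_injective
    refine (map_val_ends_induce _ _ _).trans (Eq.trans ?_ (Sym2.map_map _).symm)
    change H.ends (f.onE e.1) = Sym2.map (f.onV ∘ Subtype.val) _
    rw [f.ends_onE, ← map_val_ends_induce]
    exact Sym2.map_map _

def induceUniv (G : Multigraph) : Iso (G.induce Set.univ) G where
  onV := Equiv.subtypeUnivEquiv fun _ => Set.mem_univ _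
  onE := Equiv.subtypeUnivEquiv fun _ _ _ => Set.mem_univ _
  ends_onE e := (map_val_ends_induce G _ e).symm

def induceInduce (G : Multigraph) (T : Set G.V) (S : Set (G.induce T).V) :
    Iso ((G.induce T).induce S) (G.induce (Subtype.val '' S)) where
  onV :=
    { toFun := fun v => ⟨v.1.1, v.1, v.2, rfl⟩
      invFun := fun v => ⟨⟨v.1, by obtain ⟨_, ⟨w, _, rfl⟩⟩ := v; exact w.2⟩,
        by obtain ⟨_, ⟨w, hw, rfl⟩⟩ := v; exact hw⟩
      left_inv := fun _ => rfl
      right_inv := fun _ => rfl }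
  onE :=
    { toFun := fun e => ⟨e.1.1, fun v hv => by
        rw [← map_val_ends_induce] at hv
        obtain ⟨w, hw, rfl⟩ := Sym2.mem_map.1 hv
        exact ⟨w, e.2 w hw, rfl⟩⟩
      invFun := fun e => ⟨⟨e.1, fun v hv => by
          obtain ⟨w, _, rfl⟩ := e.2 v hv
          exact w.2⟩, fun v hv => by
        have : v.1 ∈ G.ends e.1 := by
          rw [← map_val_ends_induce G T ⟨e.1, fun v hv => by
            obtain ⟨w, _, rfl⟩ := e.2 v hv
            exact w.2⟩]
          exact Sym2.mem_map.2 ⟨v, hv, rfl⟩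
        obtain ⟨w, hw, h⟩ := e.2 _ this
        rwa [← Subtype.ext h]⟩
      left_inv := fun _ => rfl
      right_inv := fun _ => rfl }
  ends_onE e := by
    apply Sym2.map.injective Subtype.val_injective
    refine (map_val_ends_induce _ _ _).trans (Eq.trans ?_ (Sym2.map_map _).symm)
    change G.ends e.1.1 = Sym2.map (Subtype.val ∘ Subtype.val) _
    rw [← map_val_ends_induce, ← map_val_ends_induce]
    exact Sym2.map_map _

def induceDisjUnion (G H : Multigraph) (S : Set G.V) (T : Set H.V) :
    Iso ((G.induce S).disjUnion (H.induce T))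
      ((G.disjUnion H).induce (Sum.elim (· ∈ S) (· ∈ T))) where
  onV := (Equiv.subtypeSum (p := Sum.elim (· ∈ S) (· ∈ T))).symm
  onE :=
    ((Equiv.subtypeSum
        (p := fun e => ∀ v ∈ (G.disjUnion H).ends e, v ∈ {v | Sum.elim (· ∈ S) (· ∈ T) v})).trans
      (Equiv.sumCongr
        (Equiv.subtypeEquivRight fun e => by
          change (∀ v ∈ (G.ends e).map Sum.inl, Sum.elim (· ∈ S) (· ∈ T) v) ↔ _
          cases G.ends e with | _ x y => simp)
        (Equiv.subtypeEquivRight fun e => by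
          change (∀ v ∈ (H.ends e).map Sum.inr, Sum.elim (· ∈ S) (· ∈ T) v) ↔ _
          cases H.ends e with | _ x y => simp))).symm
  ends_onE e := by
    apply Sym2.map.injective Subtype.val_injective
    refine (map_val_ends_induce _ _ _).trans (Eq.trans ?_ (Sym2.map_map _).symm)
    rcases e with e | e
    · change (G.ends e.1).map Sum.inl = (((G.induce S).ends e).map Sum.inl).map _
      rw [← map_val_ends_induce]
      cases (G.induce S).ends e with | _ x y => rfl
    · change (H.ends e.1).map Sum.inr = (((H.induce T).ends e).map Sum.inr).map _
      rw [← map_val_ends_induce]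
      cases (H.induce T).ends e with | _ x y => rfl

end Multigraph

open Multigraph

/-- Isomorphism classes of finite graphs. -/
def GraphClass : Type 1 := Quotient Multigraph.isoSetoid

/-- The isomorphism class of a graph. -/
def Multigraph.cls (G : Multigraph) : GraphClass := Quotient.mk _ G

namespace GraphClass

lemma cls_eq {G H : Multigraph} (f : Iso G H) : G.cls = H.cls := Quotient.sound ⟨f⟩

lemma ind {p : GraphClass → Prop} (h : ∀ G : Multigraph, p G.cls) (c : GraphClass) : p c :=
  Quotient.ind h c

/-- Isomorphism classes of graphs form a commutative monoid under disjoint union, with the class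
of the empty graph as unit. -/
instance : CommMonoid GraphClass where
  mul := Quotient.map₂ disjUnion fun _ _ ⟨f⟩ _ _ ⟨g⟩ => ⟨f.disjUnion g⟩
  one := empty.cls
  mul_assoc a b c := by
    induction a using ind with | _ G
    induction b using ind with | _ H
    induction c using ind with | _ K
    exact cls_eq (disjUnionAssoc G H K)
  one_mul a := by
    induction a using ind with | _ G
    exact cls_eq (emptyDisjUnion G)
  mul_one a := by
    induction a using ind with | _ G
    exact (cls_eq (disjUnionComm G empty)).trans (cls_eq (emptyDisjUnion G))
  mul_comm a b := by
    induction a using ind with | _ G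
    induction b using ind with | _ H
    exact cls_eq (disjUnionComm G H)

lemma cls_disjUnion (G H : Multigraph) : (G.disjUnion H).cls = G.cls * H.cls := rfl

lemma cls_empty : Multigraph.empty.cls = 1 := rfl

lemma cls_eq_one (G : Multigraph) [IsEmpty G.V] : G.cls = 1 := cls_eq G.isoEmpty

end GraphClass

/-! ### The graph algebra -/

/-- The graph algebra over `F`, as an algebra: the vector space with basis the isomorphism classes
of finite graphs, multiplied by disjoint union. (A copy of the monoid algebra, because the
coproduct is not the one for which basis elements are group-like.) -/
def GraphAlgebra (F : Type*) [Field F] : Type _ := MonoidAlgebra F GraphClass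

namespace GraphAlgebra

variable (F : Type*) [Field F]

instance : CommRing (GraphAlgebra F) := inferInstanceAs (CommRing (MonoidAlgebra F GraphClass))

instance : Algebra F (GraphAlgebra F) := inferInstanceAs (Algebra F (MonoidAlgebra F GraphClass))

/-- The basis elements of the graph algebra. -/
def ofClass : GraphClass →* GraphAlgebra F := MonoidAlgebra.of F GraphClass

/-- A graph as an element of the graph algebra. -/
def ofGraph (G : Multigraph) : GraphAlgebra F := ofClass F G.cls

lemma ofGraph_eq {G H : Multigraph} (f : Iso G H) : ofGraph F G = ofGraph F H :=
  congrArg (ofClass F) (GraphClass.cls_eq f)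

lemma ofGraph_disjUnion (G H : Multigraph) :
    ofGraph F (G.disjUnion H) = ofGraph F G * ofGraph F H :=
  (congrArg (ofClass F) (GraphClass.cls_disjUnion G H)).trans (map_mul (ofClass F) _ _)

lemma ofGraph_of_isEmpty (G : Multigraph) [IsEmpty G.V] : ofGraph F G = 1 := by
  rw [ofGraph, GraphClass.cls_eq_one, map_one]

/-- Algebra homomorphisms from the graph algebra are multiplicative functions of graphs. -/
def lift {A : Type*} [CommRing A] [Algebra F A] (f : GraphClass →* A) : GraphAlgebra F →ₐ[F] A :=
  MonoidAlgebra.lift F A GraphClass f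

lemma lift_ofGraph {A : Type*} [CommRing A] [Algebra F A] (f : GraphClass →* A)
    (G : Multigraph) : lift F f (ofGraph F G) = f G.cls :=
  MonoidAlgebra.lift_of f G.cls

variable {F} in
lemma algHom_ext {A : Type*} [CommRing A] [Algebra F A] {f g : GraphAlgebra F →ₐ[F] A}
    (h : ∀ G, f (ofGraph F G) = g (ofGraph F G)) : f = g := by
  refine (MonoidAlgebra.lift F A GraphClass).symm.injective (MonoidHom.ext fun c => ?_)
  induction c using GraphClass.ind with | _ G
  exact h G

/-- `∑_T G|_T ⊗ G|_{Tᶜ}`, the sum over all vertex sets `T` of `G`. -/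
def comulGraph (G : Multigraph) : GraphAlgebra F ⊗[F] GraphAlgebra F :=
  ∑ T : Set G.V, ofGraph F (G.induce T) ⊗ₜ[F] ofGraph F (G.induce Tᶜ)

lemma comulGraph_eq {G H : Multigraph} (f : Iso G H) : comulGraph F G = comulGraph F H := by
  refine (Fintype.sum_equiv (Equiv.Set.congr f.onV).symm _ _ fun T => ?_).symm
  have h : ((Equiv.Set.congr f.onV).symm T : Set G.V) = f.onV ⁻¹' T :=
    f.onV.symm.image_eq_preimage_symm T
  rw [h, ← Set.preimage_compl, ofGraph_eq F (f.induce T), ofGraph_eq F (f.induce Tᶜ)]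

lemma comulGraph_empty (G : Multigraph) [IsEmpty G.V] : comulGraph F G = 1 := by
  have h (T : Set G.V) : IsEmpty (G.induce T).V := ⟨fun v => isEmptyElim v.1⟩
  rw [comulGraph, Fintype.sum_unique, ofGraph_of_isEmpty, ofGraph_of_isEmpty]
  rfl

lemma comulGraph_disjUnion (G H : Multigraph) :
    comulGraph F (G.disjUnion H) = comulGraph F G * comulGraph F H := by
  let e : Set G.V × Set H.V ≃ Set (G.disjUnion H).V :=
    { toFun := fun p => {v | Sum.elim (· ∈ p.1) (· ∈ p.2) v}
      invFun := fun T => (Sum.inl ⁻¹' T, Sum.inr ⁻¹' T)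
      left_inv := fun p => rfl
      right_inv := fun T => by
        ext (v | v) <;> rfl }
  rw [comulGraph, ← e.sum_comp, Fintype.sum_prod_type, comulGraph, comulGraph,
    Finset.sum_mul_sum]
  refine Finset.sum_congr rfl fun S _ => Finset.sum_congr rfl fun T _ => ?_
  have h : (e (S, T))ᶜ = e (Sᶜ, Tᶜ) := by
    ext (v | v) <;> rfl
  rw [h, Algebra.TensorProduct.tmul_mul_tmul, ← ofGraph_disjUnion, ← ofGraph_disjUnion,
    ofGraph_eq F (induceDisjUnion G H S T), ofGraph_eq F (induceDisjUnion G H Sᶜ Tᶜ)]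
  rfl

/-- The coproduct `Δ(G) = ∑_T G|_T ⊗ G|_{Tᶜ}`. -/
def comulHom : GraphAlgebra F →ₐ[F] GraphAlgebra F ⊗[F] GraphAlgebra F :=
  lift F
    { toFun := Quotient.lift (comulGraph F) fun _ _ ⟨f⟩ => comulGraph_eq F f
      map_one' := comulGraph_empty F empty
      map_mul' := fun a b => by
        induction a using GraphClass.ind with | _ G
        induction b using GraphClass.ind with | _ H
        exact comulGraph_disjUnion F G H }

lemma comulHom_ofGraph (G : Multigraph) :
    comulHom F (ofGraph F G) = ∑ T : Set G.V, ofGraph F (G.induce T) ⊗ₜ ofGraph F (G.induce Tᶜ) :=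
  lift_ofGraph F _ G

open Classical in
/-- `1` for the empty graph, `0` for all other graphs. -/
def counitGraph (G : Multigraph) : F := if IsEmpty G.V then 1 else 0

/-- The counit: `1` on the empty graph, `0` on all other graphs. -/
def counitHom : GraphAlgebra F →ₐ[F] F :=
  lift F
    { toFun := Quotient.lift (counitGraph F) fun _ _ ⟨f⟩ => by
        rw [counitGraph, counitGraph, f.onV.isEmpty_congr]
      map_one' := if_pos (inferInstanceAs (IsEmpty empty.V))
      map_mul' := fun a b => by
        induction a using GraphClass.ind with | _ G
        induction b using GraphClass.ind with | _ H
        classical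
        change counitGraph F (G.disjUnion H) = counitGraph F G * counitGraph F H
        have h : counitGraph F (G.disjUnion H) = if IsEmpty G.V ∧ IsEmpty H.V then 1 else 0 :=
          if_congr (isEmpty_sum (α := G.V) (β := H.V)) rfl rfl
        rw [h, counitGraph, counitGraph]
        by_cases hG : IsEmpty G.V <;> by_cases hH : IsEmpty H.V <;> simp [hG, hH] }

open Classical in
lemma counitHom_ofGraph (G : Multigraph) :
    counitHom F (ofGraph F G) = if IsEmpty G.V then 1 else 0 :=
  lift_ofGraph F _ G

lemma isEmpty_induce {G : Multigraph} {T : Set G.V} : IsEmpty (G.induce T).V ↔ T = ∅ :=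
  Set.isEmpty_coe_sort

open Classical in
lemma comulHom_induce (G : Multigraph) (T : Set G.V) :
    comulHom F (ofGraph F (G.induce T)) =
      ∑ A : Set G.V with A ⊆ T, ofGraph F (G.induce A) ⊗ₜ ofGraph F (G.induce (T \ A)) := by
  rw [comulHom_ofGraph]
  refine Finset.sum_bij' (fun S _ => Subtype.val '' S) (fun A _ => Subtype.val ⁻¹' A) ?_ ?_ ?_ ?_ ?_
  · intro S _
    simp only [Finset.mem_filter, Finset.mem_univ, true_and]
    rintro _ ⟨v, _, rfl⟩
    exact v.2
  · simp
  · intro S _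
    exact Set.preimage_image_eq S Subtype.val_injective
  · intro A hA
    simp only [Finset.mem_filter, Finset.mem_univ, true_and] at hA
    exact Subtype.image_preimage_val T A |>.trans (Set.inter_eq_right.2 hA)
  · intro S _
    have h : (fun v : (G.induce T).V => v.1) '' Sᶜ = T \ (fun v : (G.induce T).V => v.1) '' S := by
      ext v
      constructor
      · rintro ⟨w, hw, rfl⟩
        exact ⟨w.2, fun ⟨x, hx, h⟩ => hw (Subtype.ext h ▸ hx)⟩
      · rintro ⟨hv, h⟩
        exact ⟨⟨v, hv⟩, fun hS => h ⟨⟨v, hv⟩, hS, rfl⟩, rfl⟩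
    rw [ofGraph_eq F (induceInduce G T S), ofGraph_eq F (induceInduce G T Sᶜ)]
    exact congrArg (fun B => _ ⊗ₜ[F] ofGraph F (G.induce B)) h

/-- The graph algebra is a bialgebra. -/
instance : Bialgebra F (GraphAlgebra F) :=
  Bialgebra.ofAlgHom (comulHom F) (counitHom F)
    (algHom_ext fun G => by
      classical
      have hl : (∑ T : Set G.V, ∑ A : Set G.V with A ⊆ T, ofGraph F (G.induce A) ⊗ₜ[F]
            (ofGraph F (G.induce (T \ A)) ⊗ₜ[F] ofGraph F (G.induce Tᶜ))) =
          ∑ A : Set G.V, ∑ B : Set G.V with B ⊆ Aᶜ, ofGraph F (G.induce A) ⊗ₜ[F]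
            (ofGraph F (G.induce B) ⊗ₜ[F] ofGraph F (G.induce (Aᶜ \ B))) := by
        rw [Finset.sum_sigma', Finset.sum_sigma']
        refine Finset.sum_bij' (fun p _ => ⟨p.2, p.1 \ p.2⟩) (fun p _ => ⟨p.1 ∪ p.2, p.1⟩)
          ?_ ?_ ?_ ?_ ?_
        · rintro ⟨T, A⟩ h
          simp only [Finset.mem_sigma, Finset.mem_filter, Finset.mem_univ, true_and] at h ⊢
          exact fun v hv => hv.2
        · rintro ⟨A, B⟩ h
          simp
        · rintro ⟨T, A⟩ h
          simp only [Finset.mem_sigma, Finset.mem_filter, Finset.mem_univ, true_and] at h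
          simp [h]
        · rintro ⟨A, B⟩ h
          simp only [Finset.mem_sigma, Finset.mem_filter, Finset.mem_univ, true_and] at h
          have : (A ∪ B) \ A = B := by
            ext v
            have := @h v
            simp only [Set.mem_compl_iff] at this
            simp only [Set.mem_sdiff, Set.mem_union]
            tauto
          simp [this]
        · rintro ⟨T, A⟩ h
          simp only [Finset.mem_sigma, Finset.mem_filter, Finset.mem_univ, true_and] at h
          have : Aᶜ \ (T \ A) = Tᶜ := by
            ext v
            have := @h v
            simp only [Set.mem_compl_iff, Set.mem_sdiff]
            tauto
          simp only [this]
      simp only [AlgHom.comp_apply, comulHom_ofGraph F G, map_sum, Algebra.TensorProduct.map_tmul,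
        AlgHom.id_apply, comulHom_induce, TensorProduct.sum_tmul, TensorProduct.tmul_sum]
      simpa using hl)
    (algHom_ext fun G => by
      classical
      simp only [AlgHom.comp_apply, comulHom_ofGraph, map_sum, Algebra.TensorProduct.map_tmul,
        AlgHom.id_apply]
      rw [Fintype.sum_eq_single ∅]
      · rw [counitHom_ofGraph, if_pos (isEmpty_induce.2 rfl), Set.compl_empty,
          ofGraph_eq F (induceUniv G)]
        rfl
      · intro T hT
        rw [counitHom_ofGraph, if_neg (mt isEmpty_induce.1 hT), TensorProduct.zero_tmul])
    (algHom_ext fun G => by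
      classical
      simp only [AlgHom.comp_apply, comulHom_ofGraph, map_sum, Algebra.TensorProduct.map_tmul,
        AlgHom.id_apply]
      rw [Fintype.sum_eq_single Set.univ]
      · rw [counitHom_ofGraph, if_pos (isEmpty_induce.2 Set.compl_univ),
          ofGraph_eq F (induceUniv G)]
        rfl
      · intro T hT
        rw [counitHom_ofGraph, if_neg (mt isEmpty_induce.1 (mt Set.compl_empty_iff.1 hT)),
          TensorProduct.tmul_zero])

end GraphAlgebra

end

noncomputable section

namespace Multigraph

def Iso.symm {G H : Multigraph} (f : Iso G H) : Iso H G where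
  onV := f.onV.symm
  onE := f.onE.symm
  ends_onE e := by
    have h := f.ends_onE (f.onE.symm e)
    rw [Equiv.apply_symm_apply] at h
    simp [h, Sym2.map_map]

namespace Orientation

variable {G H : Multigraph}

instance : Finite G.Orientation :=
  inferInstanceAs (Finite {o : G.E → G.V × G.V // ∀ e, s((o e).1, (o e).2) = G.ends e})

lemma fst_mem (o : G.Orientation) (e : G.E) : (o.1 e).1 ∈ G.ends e := by
  rw [← o.2 e]; exact Sym2.mem_mk_left _ _

lemma snd_mem (o : G.Orientation) (e : G.E) : (o.1 e).2 ∈ G.ends e := by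
  rw [← o.2 e]; exact Sym2.mem_mk_right _ _

/-- Transport of an orientation along an isomorphism. -/
def map (f : Iso G H) (o : G.Orientation) : H.Orientation :=
  ⟨fun e => (f.onV (o.1 (f.onE.symm e)).1, f.onV (o.1 (f.onE.symm e)).2), fun e => by
    have h := f.ends_onE (f.onE.symm e)
    rw [Equiv.apply_symm_apply, ← o.2] at h
    exact h.symm⟩

lemma map_injective (f : Iso G H) : Function.Injective (map f) := by
  intro o o' h
  refine Subtype.ext (funext fun e => ?_)
  have := congrFun (congrArg Subtype.val h) (f.onE e)
  simp only [map, Equiv.symm_apply_apply, Prod.mk.injEq, EmbeddingLike.apply_eq_iff_eq] at this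
  exact Prod.ext this.1 this.2

lemma Acyclic.map {o : G.Orientation} (ho : o.Acyclic) (f : Iso G H) : (o.map f).Acyclic := by
  intro v hv
  refine ho (f.onV.symm v) (Relation.TransGen.lift f.onV.symm ?_ _ _ hv)
  rintro u w ⟨e, he⟩
  refine ⟨f.onE.symm e, ?_⟩
  rw [Prod.ext_iff] at he
  exact Prod.ext ((Equiv.symm_apply_eq _).2 he.1.symm).symm
    ((Equiv.symm_apply_eq _).2 he.2.symm).symm

/-- No arc leaves `v`. -/
def IsSink (o : G.Orientation) (v : G.V) : Prop := ∀ e, (o.1 e).1 ≠ v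

lemma Acyclic.exists_isSink [Nonempty G.V] {o : G.Orientation} (ho : o.Acyclic) :
    ∃ v, o.IsSink v := by
  let r : G.V → G.V → Prop := fun u w => ∃ e, o.1 e = (u, w)
  let R : G.V → G.V → Prop := fun u w => Relation.TransGen r w u
  have : IsTrans G.V R := ⟨fun _ _ _ h h' => h'.trans h⟩
  have : Std.Irrefl R := ⟨fun v => ho v⟩
  obtain ⟨m, -, hm⟩ := (Finite.wellFounded_of_trans_of_irrefl R).has_min Set.univ Set.univ_nonempty
  exact ⟨m, fun e he => hm (o.1 e).2 trivial (.single ⟨e, Prod.ext he rfl⟩)⟩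

/-- Restriction of an orientation to an induced subgraph. -/
def induce (o : G.Orientation) (T : Set G.V) : (G.induce T).Orientation :=
  ⟨fun e => (⟨(o.1 e.1).1, e.2 _ (o.fst_mem _)⟩, ⟨(o.1 e.1).2, e.2 _ (o.snd_mem _)⟩), fun e => by
    apply Sym2.map.injective Subtype.val_injective
    rw [map_val_ends_induce]
    exact o.2 e.1⟩

lemma Acyclic.induce {o : G.Orientation} (ho : o.Acyclic) (T : Set G.V) : (o.induce T).Acyclic := by
  intro v hv
  refine ho v.1 (Relation.TransGen.lift Subtype.val ?_ _ _ hv)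
  rintro u w ⟨e, he⟩
  refine ⟨e.1, ?_⟩
  rw [Prod.ext_iff] at he
  exact Prod.ext (congrArg Subtype.val he.1) (congrArg Subtype.val he.2)

lemma snd_mem_of_sinks {o : G.Orientation} {I : Set G.V} (hI : ∀ v ∈ I, o.IsSink v) {e : G.E}
    (he : ¬ ∀ v ∈ G.ends e, v ∈ Iᶜ) : (o.1 e).2 ∈ I := by
  push Not at he
  obtain ⟨v, hv, hvI⟩ := he
  rw [Set.mem_compl_iff, not_not] at hvI
  rw [← o.2 e, Sym2.mem_iff] at hv
  rcases hv with rfl | rfl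
  · exact absurd rfl (hI _ hvI e)
  · exact hvI

lemma eq_of_induce_eq {o o' : G.Orientation} {I : Set G.V} (hI : ∀ v ∈ I, o.IsSink v)
    (hI' : ∀ v ∈ I, o'.IsSink v) (h : o.induce Iᶜ = o'.induce Iᶜ) : o = o' := by
  refine Subtype.ext (funext fun e => ?_)
  by_cases he : ∀ v ∈ G.ends e, v ∈ Iᶜ
  · have := congrFun (congrArg Subtype.val h) ⟨e, he⟩
    rw [Prod.ext_iff] at this
    exact Prod.ext (congrArg Subtype.val this.1) (congrArg Subtype.val this.2)
  · have h2 := snd_mem_of_sinks hI he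
    have h1 := (o.2 e).trans (o'.2 e).symm
    rw [Sym2.eq_iff] at h1
    rcases h1 with h1 | h1
    · exact Prod.ext h1.1 h1.2
    · exact absurd h1.2.symm (hI' _ h2 e)

/-- An acyclic orientation outside a stable set extends so that the stable set consists of sinks. -/
lemma exists_induce_eq {I : Set G.V} (hI : ∀ e, ¬ ∀ v ∈ G.ends e, v ∈ I)
    {o : (G.induce Iᶜ).Orientation} (ho : o.Acyclic) :
    ∃ o' : G.Orientation, o'.Acyclic ∧ (∀ v ∈ I, o'.IsSink v) ∧ o'.induce Iᶜ = o := by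
  have key (e : G.E) : ∃ p : G.V × G.V, s(p.1, p.2) = G.ends e ∧ p.1 ∉ I ∧
      ∀ h : ∀ v ∈ G.ends e, v ∈ Iᶜ, p = ((o.1 ⟨e, h⟩).1.1, (o.1 ⟨e, h⟩).2.1) := by
    by_cases h : ∀ v ∈ G.ends e, v ∈ Iᶜ
    · refine ⟨((o.1 ⟨e, h⟩).1.1, (o.1 ⟨e, h⟩).2.1), ?_, (o.1 ⟨e, h⟩).1.2, fun _ => rfl⟩
      exact (congrArg (Sym2.map Subtype.val) (o.2 ⟨e, h⟩)).trans (map_val_ends_induce G Iᶜ ⟨e, h⟩)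
    · obtain ⟨v, hv, hvI⟩ : ∃ v ∈ G.ends e, v ∉ I := by simpa using hI e
      obtain ⟨w, hw⟩ := Sym2.mem_iff_exists.1 hv
      exact ⟨(v, w), hw.symm, hvI, fun h' => absurd h' h⟩
  choose f hf using key
  have hs : ∀ v ∈ I, IsSink (G := G) ⟨f, fun e => (hf e).1⟩ v := fun v hv e he =>
    (hf e).2.1 ((show (f e).1 = v from he) ▸ hv)
  refine ⟨⟨f, fun e => (hf e).1⟩, ?_, hs, ?_⟩
  · have lift {u w : G.V} (h : Relation.TransGen (fun u w => ∃ e, f e = (u, w)) u w) (hw : w ∈ Iᶜ) :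
        ∃ hu : u ∈ Iᶜ, Relation.TransGen (fun u w => ∃ e, o.1 e = (u, w)) ⟨u, hu⟩ ⟨w, hw⟩ := by
      have step {u w : G.V} (h : ∃ e, f e = (u, w)) (hw : w ∈ Iᶜ) :
          ∃ hu : u ∈ Iᶜ, ∃ e, o.1 e = (⟨u, hu⟩, ⟨w, hw⟩) := by
        obtain ⟨e, he⟩ := h
        have hu : u ∈ Iᶜ := by have := (hf e).2.1; rwa [he] at this
        have hE : ∀ v ∈ G.ends e, v ∈ Iᶜ := by
          rw [← (hf e).1, he]
          intro v hv
          rcases Sym2.mem_iff.1 hv with rfl | rfl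
          exacts [hu, hw]
        have := (hf e).2.2 hE
        rw [he, Prod.ext_iff] at this
        exact ⟨hu, ⟨e, hE⟩, Prod.ext (Subtype.ext this.1.symm) (Subtype.ext this.2.symm)⟩
      induction h using Relation.TransGen.head_induction_on with
      | single h => obtain ⟨hu, h⟩ := step h hw; exact ⟨hu, .single h⟩
      | head h _ ih =>
        obtain ⟨hc, ih⟩ := ih
        obtain ⟨hu, h⟩ := step h hc
        exact ⟨hu, .head h ih⟩
    intro v hv
    have hvI : v ∈ Iᶜ := by
      obtain ⟨w, ⟨e, he⟩, -⟩ := Relation.TransGen.head'_iff.1 hv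
      exact fun h => hs v h e (congrArg Prod.fst he)
    exact ho _ (lift hv hvI).2
  · refine Subtype.ext (funext fun e => ?_)
    have := (hf e.1).2.2 e.2
    rw [Prod.ext_iff] at this
    exact Prod.ext (Subtype.ext this.1) (Subtype.ext this.2)

end Orientation

open Multigraph.Orientation

lemma numAcyclicOrientations_le {G H : Multigraph} (f : Iso G H) :
    G.numAcyclicOrientations ≤ H.numAcyclicOrientations :=
  Nat.card_le_card_of_injective (fun o => ⟨o.1.map f, o.2.map f⟩) fun _ _ h =>
    Subtype.ext (map_injective f (congrArg Subtype.val h))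

lemma numAcyclicOrientations_eq {G H : Multigraph} (f : Iso G H) :
    G.numAcyclicOrientations = H.numAcyclicOrientations :=
  (numAcyclicOrientations_le f).antisymm (numAcyclicOrientations_le f.symm)

/-- No edge of `G` has both ends in `I`. -/
def IsStable (G : Multigraph) (I : Set G.V) : Prop := ∀ e, ¬ ∀ v ∈ G.ends e, v ∈ I

lemma card_acyclic_sinks {G : Multigraph} {I : Set G.V} (hI : G.IsStable I) :
    Nat.card {o : {o : G.Orientation // o.Acyclic} // ∀ v ∈ I, o.1.IsSink v} =
      (G.induce Iᶜ).numAcyclicOrientations := by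
  refine Nat.card_congr (Equiv.ofBijective (fun o => ⟨o.1.1.induce Iᶜ, o.1.2.induce Iᶜ⟩) ⟨?_, ?_⟩)
  · intro o o' h
    exact Subtype.ext (Subtype.ext (eq_of_induce_eq o.2 o'.2 (congrArg Subtype.val h)))
  · rintro ⟨o, ho⟩
    obtain ⟨o', h1, h2, h3⟩ := exists_induce_eq hI ho
    exact ⟨⟨⟨o', h1⟩, h2⟩, Subtype.ext h3⟩

lemma IsStable.of_sinks {G : Multigraph} {I : Set G.V} {o : G.Orientation}
    (h : ∀ v ∈ I, o.IsSink v) : G.IsStable I :=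
  fun e he => h _ (he _ (o.fst_mem e)) e rfl

open Classical in
lemma sum_subset_neg_one_pow_ncard_compl {R : Type*} [CommRing R] {V : Type*} [Fintype V] (S : Set V) (hS : S.Nonempty) :
    ∑ I : Set V, (if I ⊆ S then (-1 : R) ^ Iᶜ.ncard else 0) = 0 := by
  obtain ⟨s, hs⟩ := hS
  have key (I : Set V) (hI : s ∉ I) : Iᶜ.ncard = (insert s I)ᶜ.ncard + 1 := by
    rw [← Set.ncard_insert_of_notMem (a := s) (s := (insert s I)ᶜ) (by simp)]
    congr 1
    ext v
    by_cases hv : v = s <;> simp [hv, hI]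
  refine Finset.sum_involution (fun I _ => if s ∈ I then I \ {s} else insert s I) ?_ ?_ ?_ ?_
  · intro I _
    by_cases hI : s ∈ I
    · have h := key (I \ {s}) (by simp)
      rw [Set.insert_sdiff_singleton, Set.insert_eq_of_mem hI] at h
      have h' : I \ {s} ⊆ S ↔ I ⊆ S := by
        rw [Set.sdiff_singleton_subset_iff, Set.insert_eq_of_mem hs]
      simp only [if_pos hI, h, h']
      split_ifs <;> ring
    · have h' : insert s I ⊆ S ↔ I ⊆ S := by simp [Set.insert_subset_iff, hs]
      simp only [if_neg hI, key I hI, h']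
      split_ifs <;> ring
  · intro I _ _ h
    by_cases hI : s ∈ I
    · rw [if_pos hI] at h
      rw [← h] at hI
      simp at hI
    · rw [if_neg hI] at h
      rw [← h] at hI
      simp at hI
  · intros; exact Finset.mem_univ _
  · intro I _
    by_cases hI : s ∈ I
    · simp [hI]
    · simp [hI]

open Classical in
theorem sum_stable_numAcyclicOrientations (R : Type*) [CommRing R] (G : Multigraph) :
    ∑ I : Set G.V with G.IsStable I,
      (-1 : R) ^ Iᶜ.ncard * ((G.induce Iᶜ).numAcyclicOrientations : R) =
      if IsEmpty G.V then 1 else 0 := by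
  let _ : Fintype {o : G.Orientation // o.Acyclic} := Fintype.ofFinite _
  have h1 (I : Set G.V) : (if G.IsStable I then
      (-1 : R) ^ Iᶜ.ncard * ((G.induce Iᶜ).numAcyclicOrientations : R) else 0) =
      ∑ o : {o : G.Orientation // o.Acyclic},
        if I ⊆ {v | o.1.IsSink v} then (-1 : R) ^ Iᶜ.ncard else 0 := by
    split_ifs with hI
    · rw [← card_acyclic_sinks hI, Nat.card_eq_fintype_card, Fintype.card_subtype,
        Finset.card_filter, Nat.cast_sum, Finset.mul_sum]
      refine Finset.sum_congr rfl fun o _ => ?_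
      rw [Nat.cast_ite, Nat.cast_one, Nat.cast_zero, mul_ite, mul_one, mul_zero]
      exact if_congr Iff.rfl rfl rfl
    · refine (Finset.sum_eq_zero fun o _ => if_neg fun h => hI ?_).symm
      exact IsStable.of_sinks h
  rw [Finset.sum_filter, Finset.sum_congr rfl fun I _ => h1 I, Finset.sum_comm]
  split_ifs with hV
  · have hE : IsEmpty G.E := ⟨fun e => isEmptyElim (G.ends e).out.1⟩
    let o : {o : G.Orientation // o.Acyclic} :=
      ⟨⟨fun e => isEmptyElim e, fun e => isEmptyElim e⟩, fun v => isEmptyElim v⟩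
    rw [Fintype.sum_eq_single o]
    · rw [Fintype.sum_eq_single ∅]
      · simp [Set.eq_empty_of_isEmpty]
      · intro I hI
        exact absurd (Set.eq_empty_of_isEmpty I) hI
    · intro o' h
      exact absurd (Subtype.ext (Subtype.ext (funext fun e => isEmptyElim e))) h
  · rw [not_isEmpty_iff] at hV
    exact Finset.sum_eq_zero fun o _ => sum_subset_neg_one_pow_ncard_compl _ o.2.exists_isSink

end Multigraph

namespace Multigraph

variable {G : Multigraph} {A F : Set G.E}

lemma AdjIn.symm {u v : G.V} : G.AdjIn F u v → G.AdjIn F v u :=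
  fun ⟨e, he, h⟩ => ⟨e, he, h.trans Sym2.eq_swap⟩

lemma AdjIn.mono (h : A ⊆ F) {u v : G.V} : G.AdjIn A u v → G.AdjIn F u v :=
  fun ⟨e, he, h'⟩ => ⟨e, h he, h'⟩

lemma mk_adjIn_eq_iff {u v : G.V} :
    Quot.mk (G.AdjIn F) u = Quot.mk (G.AdjIn F) v ↔ Relation.ReflTransGen (G.AdjIn F) u v := by
  constructor
  · intro h
    have h' := Quot.eqvGen_exact h
    clear h
    induction h' with
    | rel _ _ h => exact .single h
    | refl => exact .refl
    | symm _ _ _ ih =>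
      have : Std.Symm (G.AdjIn F) := ⟨fun _ _ => AdjIn.symm⟩
      exact Std.Symm.symm _ _ ih
    | trans _ _ _ _ _ ih ih' => exact ih.trans ih'
  · intro h
    induction h with
    | refl => rfl
    | tail _ h ih => exact ih.trans (Quot.sound h)

/-- The number of connected components of the spanning subgraph with edge set `F`. -/
def numComponents (G : Multigraph) (F : Set G.E) : ℕ := Nat.card (Quot (G.AdjIn F))

lemma numComponents_empty (G : Multigraph) : G.numComponents ∅ = Nat.card G.V :=
  Nat.card_congr
    { toFun := Quot.lift id fun _ _ ⟨_, h, _⟩ => h.elim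
      invFun := Quot.mk _
      left_inv := by rintro ⟨v⟩; rfl
      right_inv := fun _ => rfl }

lemma numComponents_anti (h : A ⊆ F) : G.numComponents F ≤ G.numComponents A :=
  Nat.card_le_card_of_surjective (Quot.map id fun _ _ => AdjIn.mono h) <| by
    rintro ⟨v⟩
    exact ⟨Quot.mk _ v, rfl⟩

open Classical in
lemma numComponents_insert_of_not_conn {e : G.E} {u w : G.V} (he : G.ends e = s(u, w))
    (h : ¬ Relation.ReflTransGen (G.AdjIn F) u w) :
    G.numComponents (insert e F) + 1 = G.numComponents F := by
  rw [← mk_adjIn_eq_iff] at h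
  let b := Quot.mk (G.AdjIn F) w
  let φ : Quot (G.AdjIn F) → Quot (G.AdjIn (insert e F)) :=
    Quot.map id fun _ _ => AdjIn.mono (Set.subset_insert e F)
  have hφ : φ (Quot.mk _ u) = φ b := Quot.sound ⟨e, Set.mem_insert e F, he⟩
  let E : Quot (G.AdjIn (insert e F)) ≃ {q // q ≠ b} :=
    { toFun := Quot.lift (fun x => if hx : Quot.mk _ x = b then ⟨Quot.mk _ u, h⟩
          else ⟨Quot.mk _ x, hx⟩) <| by
        rintro x y ⟨f, rfl | hf, hxy⟩
        · rw [he, Sym2.eq_iff] at hxy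
          rcases hxy with ⟨rfl, rfl⟩ | ⟨rfl, rfl⟩
          · rw [dif_neg h, dif_pos rfl]
          · rw [dif_pos rfl, dif_neg h]
        · have : Quot.mk (G.AdjIn F) x = Quot.mk _ y := Quot.sound ⟨f, hf, hxy⟩
          simp only [this]
      invFun := fun q => φ q.1
      left_inv := by
        rintro ⟨x⟩
        by_cases hx : Quot.mk _ x = b
        · change φ (dite _ _ _ : {q // q ≠ b}).1 = _
          rw [dif_pos hx, hφ, ← hx]
          rfl
        · change φ (dite _ _ _ : {q // q ≠ b}).1 = _
          rw [dif_neg hx]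
          rfl
      right_inv := by
        rintro ⟨⟨x⟩, hx⟩
        exact dif_neg hx }
  rw [numComponents, Nat.card_congr E, numComponents, ← Nat.card_congr (Equiv.optionSubtypeNe b),
    Finite.card_option]

lemma IsAcyclic.mono (h : A ⊆ F) (hF : G.IsAcyclic F) : G.IsAcyclic A :=
  fun ⟨k, v, e, hv, he, hA⟩ => hF ⟨k, v, e, hv, he, fun i => ⟨h (hA i).1, (hA i).2⟩⟩

lemma isAcyclic_empty : G.IsAcyclic ∅ := fun ⟨_, _, _, _, _, h⟩ => (h 0).1

open Fin.NatCast in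
/-- Adding an edge between different components does not create a cycle. -/
lemma IsAcyclic.insert_of_not_conn {e : G.E} {u w : G.V} (he : G.ends e = s(u, w))
    (hA : G.IsAcyclic A) (h : ¬ Relation.ReflTransGen (G.AdjIn A) u w) : G.IsAcyclic (insert e A) := by
  rintro ⟨k, v, f, hv, hf, hfA⟩
  by_cases hall : ∀ i, f i ∈ A
  · exact hA ⟨k, v, f, hv, hf, fun i => ⟨hall i, (hfA i).2⟩⟩
  push Not at hall
  obtain ⟨j, hj⟩ := hall
  have hje : f j = e := (hfA j).1.resolve_right hj
  have hother (i) (hi : i ≠ j) : f i ∈ A :=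
    (hfA i).1.resolve_left fun h => hi (hf (h.trans hje.symm))
  have hcast (m : ℕ) : 1 + (m : Fin (k + 1)) = ((m + 1 : ℕ) : Fin (k + 1)) := by
    rw [Nat.cast_add, Nat.cast_one]; exact add_comm _ _
  have walk (m : ℕ) (hm : m ≤ k) :
      Quot.mk (G.AdjIn A) (v (j + 1 + (m : Fin (k + 1)))) = Quot.mk _ (v (j + 1)) := by
    induction m with
    | zero => simp
    | succ m ih =>
      rw [← ih (by omega)]
      have hne : j + 1 + (m : Fin (k + 1)) ≠ j := by
        intro h
        rw [add_assoc, add_eq_left, hcast] at h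
        have := congrArg Fin.val h
        rw [Fin.val_natCast, Nat.mod_eq_of_lt (by omega)] at this
        simp at this
      refine (Quot.sound ⟨_, hother _ hne, ?_⟩).symm
      rw [(hfA _).2, Nat.cast_succ, ← add_assoc]
  have hk := walk k le_rfl
  have : j + 1 + (k : Fin (k + 1)) = j := by
    rw [add_assoc, add_eq_left, hcast]
    exact Fin.natCast_self _
  rw [this] at hk
  have h2 := (hfA j).2
  rw [hje, he, Sym2.eq_iff] at h2
  rw [← mk_adjIn_eq_iff] at h
  rcases h2 with ⟨rfl, rfl⟩ | ⟨rfl, rfl⟩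
  · exact h hk
  · exact h hk.symm

/-- An edge closing up a path creates a cycle. -/
lemma IsAcyclic.not_conn {e : G.E} {u w : G.V} (he : G.ends e = s(u, w)) (heA : e ∉ A)
    (hA : G.IsAcyclic (insert e A)) : ¬ Relation.ReflTransGen (G.AdjIn A) u w := by
  intro h
  let H : SimpleGraph G.V := SimpleGraph.fromRel (G.AdjIn A)
  have hreach : H.Reachable u w := by
    clear he
    induction h with
    | refl => exact .refl _
    | @tail b c _ hbc ih =>
      by_cases hb : b = c
      · subst hb; exact ih
      · exact ih.trans (SimpleGraph.Adj.reachable ⟨hb, .inl hbc⟩)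
  obtain ⟨p, hp⟩ := hreach.exists_isPath
  have hadj (i : ℕ) (hi : i < p.length) : G.AdjIn A (p.getVert i) (p.getVert (i + 1)) :=
    (p.adj_getVert_succ hi).2.elim id AdjIn.symm
  choose f hfA hf using hadj
  refine hA ⟨p.length, fun i => p.getVert i,
    fun i => if h : i.1 < p.length then f i h else e, ?_, ?_, ?_⟩
  · intro i j hij
    exact Fin.ext (hp.getVert_injOn (Nat.lt_succ_iff.1 i.2) (Nat.lt_succ_iff.1 j.2) hij)
  · intro i j hij
    by_cases hi : i.1 < p.length <;> by_cases hj : j.1 < p.length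
    · simp only [dif_pos hi, dif_pos hj] at hij
      have h := (hf i hi).symm.trans ((congrArg G.ends hij).trans (hf j hj))
      rw [Sym2.eq_iff] at h
      rcases h with h | h
      · exact Fin.ext (hp.getVert_injOn hi.le hj.le h.1)
      · have h1 := hp.getVert_injOn (by exact hi.le) (by exact hj) h.1
        have h2 := hp.getVert_injOn (by exact hi) (by exact hj.le) h.2
        omega
    · simp only [dif_pos hi, dif_neg hj] at hij
      exact absurd (hij ▸ hfA i hi) heA
    · simp only [dif_neg hi, dif_pos hj] at hij
      exact absurd (hij ▸ hfA j hj) heA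
    · have := i.2
      have := j.2
      omega
  · intro i
    by_cases hi : i.1 < p.length
    · simp only [dif_pos hi]
      refine ⟨Set.mem_insert_of_mem _ (hfA i hi), ?_⟩
      rw [hf, Fin.val_add_one_of_lt (show i < Fin.last _ from hi)]
    · have hi' : i = Fin.last _ := Fin.ext (by have := i.2; rw [Fin.val_last]; omega)
      subst hi'
      simp only [dif_neg hi]
      refine ⟨Set.mem_insert _ _, ?_⟩
      rw [Fin.last_add_one, Fin.val_last, Fin.val_zero, p.getVert_length, p.getVert_zero, he]
      exact Sym2.eq_swap

lemma numComponents_le_of_conn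
    (h : ∀ u v, G.AdjIn F u v → Relation.ReflTransGen (G.AdjIn A) u v) :
    G.numComponents A ≤ G.numComponents F :=
  Nat.card_le_card_of_surjective
    (Quot.lift (Quot.mk (G.AdjIn A)) fun u v huv => mk_adjIn_eq_iff.2 (h u v huv)) <| by
    rintro ⟨v⟩
    exact ⟨Quot.mk _ v, rfl⟩

lemma exists_isAcyclic (F : Set G.E) :
    ∃ A ⊆ F, G.IsAcyclic A ∧ G.numComponents A ≤ G.numComponents F := by
  obtain ⟨A, ⟨hAF, hA⟩, hmax⟩ := (Set.toFinite {A | A ⊆ F ∧ G.IsAcyclic A}).exists_maximal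
    ⟨∅, Set.empty_subset F, isAcyclic_empty⟩
  refine ⟨A, hAF, hA, numComponents_le_of_conn ?_⟩
  rintro u v ⟨e, he, huv⟩
  by_contra h
  exact h (.single ⟨e, hmax ⟨Set.insert_subset he hAF, hA.insert_of_not_conn huv h⟩
    (Set.subset_insert e A) (Set.mem_insert e A), huv⟩)

lemma IsAcyclic.ncard_add (hA : G.IsAcyclic A) :
    A.ncard + G.numComponents A = Nat.card G.V := by
  induction A, Set.toFinite A using Set.Finite.induction_on with
  | empty => rw [Set.ncard_empty, zero_add, numComponents_empty]
  | @insert e A he _ ih =>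
    obtain ⟨u, w, h⟩ : ∃ u w, G.ends e = s(u, w) := by
      induction h : G.ends e with | _ u w => exact ⟨u, w, rfl⟩
    rw [Set.ncard_insert_of_notMem he, ← ih (hA.mono (Set.subset_insert e A)),
      ← numComponents_insert_of_not_conn h (IsAcyclic.not_conn h he hA)]
    omega

theorem rk_add_numComponents (F : Set G.E) : G.rk F + G.numComponents F = Nat.card G.V := by
  obtain ⟨A, hAF, hA, h⟩ := exists_isAcyclic F
  have h1 := hA.ncard_add
  have h2 := numComponents_anti hAF
  suffices h : G.rk F = A.ncard by omega
  have hle : ∀ m ∈ {m | ∃ A ⊆ F, G.IsAcyclic A ∧ A.ncard = m}, m ≤ A.ncard := by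
    rintro _ ⟨B, hBF, hB, rfl⟩
    have := hB.ncard_add
    have := numComponents_anti hBF
    omega
  exact le_antisymm (csSup_le ⟨_, A, hAF, hA, rfl⟩ hle) (le_csSup ⟨_, hle⟩ ⟨A, hAF, hA, rfl⟩)

end Multigraph

namespace Multigraph

variable {G H : Multigraph}

/-- An isomorphism from bijective maps on vertices and edges. -/
def Iso.ofBijective (fV : G.V → H.V) (fE : G.E → H.E) (hV : fV.Bijective) (hE : fE.Bijective)
    (h : ∀ e, H.ends (fE e) = (G.ends e).map fV) : Iso G H :=
  ⟨.ofBijective fV hV, .ofBijective fE hE, h⟩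

lemma exists_ends (G : Multigraph) (e : G.E) : ∃ u v, G.ends e = s(u, v) := by
  induction h : G.ends e with | _ u v => exact ⟨u, v, rfl⟩

lemma not_ends_subset_compl {T : Set G.V} {e : G.E} (h : ∀ v ∈ G.ends e, v ∈ T) :
    ¬ ∀ v ∈ G.ends e, v ∈ Tᶜ := by
  obtain ⟨u, v, he⟩ := G.exists_ends e
  have hu : u ∈ G.ends e := he ▸ Sym2.mem_mk_left u v
  exact fun h' => h' u hu (h u hu)

/-- The edges of `F` that lie in the induced subgraph on `T`. -/
def restrictEdges (F : Set G.E) (T : Set G.V) : Set (G.induce T).E := {e | e.1 ∈ F}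

/-- No edge of `F` joins `T` to its complement. -/
def NoCrossing (F : Set G.E) (T : Set G.V) : Prop :=
  ∀ e ∈ F, (∀ v ∈ G.ends e, v ∈ T) ∨ ∀ v ∈ G.ends e, v ∈ Tᶜ

/-- `F` contains all the edges inside `T` and no edge between `T` and its complement. -/
structure Splits (F : Set G.E) (T : Set G.V) : Prop where
  mem : ∀ e, (∀ v ∈ G.ends e, v ∈ T) → e ∈ F
  noCrossing : NoCrossing F T

variable {F : Set G.E} {T : Set G.V}

lemma NoCrossing.conn_induce (h : NoCrossing F T) {u v : G.V} (hu : u ∈ Tᶜ)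
    (huv : Relation.ReflTransGen (G.AdjIn F) u v) :
    ∃ hv : v ∈ Tᶜ, Relation.ReflTransGen ((G.induce Tᶜ).AdjIn (restrictEdges F Tᶜ))
      ⟨u, hu⟩ ⟨v, hv⟩ := by
  induction huv with
  | refl => exact ⟨hu, .refl⟩
  | @tail b c _ hbc ih =>
    obtain ⟨hb, ih⟩ := ih
    obtain ⟨e, he, hbc⟩ := hbc
    have hE : ∀ v ∈ G.ends e, v ∈ Tᶜ :=
      (h e he).resolve_left fun h' => hb (h' b (hbc ▸ Sym2.mem_mk_left b c))
    have hc : c ∈ Tᶜ := hE c (hbc ▸ Sym2.mem_mk_right b c)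
    refine ⟨hc, ih.tail ⟨⟨e, hE⟩, he, ?_⟩⟩
    apply Sym2.map.injective Subtype.val_injective
    exact (map_val_ends_induce _ _ _).trans hbc

lemma adjIn_of_adjIn_induce {u v : (G.induce T).V}
    (h : (G.induce T).AdjIn (restrictEdges F T) u v) : G.AdjIn F u.1 v.1 := by
  obtain ⟨e, he, h⟩ := h
  refine ⟨e.1, he, ?_⟩
  rw [← map_val_ends_induce, h]
  rfl

lemma IsFlat.restrictEdges (hF : G.IsFlat F) (T : Set G.V) :
    (G.induce T).IsFlat (restrictEdges F T) := by
  intro e u v he huv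
  refine hF e.1 u.1 v.1 ?_ (Relation.ReflTransGen.lift Subtype.val
    (fun _ _ => adjIn_of_adjIn_induce) _ _ huv)
  rw [← map_val_ends_induce, he]
  rfl

lemma Splits.isFlat (h : Splits F T) (hF : (G.induce Tᶜ).IsFlat (G.restrictEdges F Tᶜ)) :
    G.IsFlat F := by
  intro e u v he huv
  by_cases hu : u ∈ Tᶜ
  · obtain ⟨hv, huv'⟩ := h.noCrossing.conn_induce hu huv
    have hE : ∀ w ∈ G.ends e, w ∈ Tᶜ := by
      rw [he]
      intro w hw
      rcases Sym2.mem_iff.1 hw with rfl | rfl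
      exacts [hu, hv]
    refine hF ⟨e, hE⟩ _ _ ?_ huv'
    apply Sym2.map.injective Subtype.val_injective
    exact (map_val_ends_induce _ _ _).trans he
  · refine h.mem e ?_
    rw [he]
    intro w hw
    rcases Sym2.mem_iff.1 hw with rfl | rfl
    · exact not_not.1 hu
    · by_contra hv
      exact hu (h.noCrossing.conn_induce hv
        (mk_adjIn_eq_iff.1 (mk_adjIn_eq_iff.2 huv).symm)).1

/-- The edge set consisting of all edges inside `T` and the edges `S` outside `T`. -/
def extendEdges (T : Set G.V) (S : Set (G.induce Tᶜ).E) : Set G.E :=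
  {e | (∀ v ∈ G.ends e, v ∈ T) ∨ ∃ h, (⟨e, h⟩ : (G.induce Tᶜ).E) ∈ S}

lemma restrictEdges_extendEdges (S : Set (G.induce Tᶜ).E) :
    restrictEdges (extendEdges T S) Tᶜ = S := by
  ext e
  constructor
  · rintro (h | ⟨_, h⟩)
    · exact absurd e.2 (not_ends_subset_compl h)
    · exact h
  · exact fun h => .inr ⟨e.2, h⟩

lemma splits_extendEdges (S : Set (G.induce Tᶜ).E) : Splits (extendEdges T S) T where
  mem _ h := .inl h
  noCrossing _ h := h.imp_right fun h' => h'.1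

lemma Splits.extendEdges_restrictEdges (h : Splits F T) :
    extendEdges T (restrictEdges F Tᶜ) = F := by
  ext e
  constructor
  · rintro (h' | ⟨_, h'⟩)
    exacts [h.mem e h', h']
  · exact fun he => (h.noCrossing e he).imp_right fun h' => ⟨h', he⟩

open Classical in
/-- If `F` splits along `T`, then the spanning subgraph with edge set `F` is a disjoint union. -/
def Splits.iso (h : Splits F T) :
    Iso ((G.induce T).disjUnion ((G.induce Tᶜ).spanning (restrictEdges F Tᶜ))) (G.spanning F) where
  onV := Equiv.Set.sumCompl T
  onE := Equiv.ofBijective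
    (Sum.elim (fun e => ⟨e.1, h.mem e.1 e.2⟩) fun e => ⟨e.1.1, e.2⟩ :
      (G.induce T).E ⊕ {e // e ∈ G.restrictEdges F Tᶜ} → {e // e ∈ F}) <| by
    constructor
    · rintro (e | e) (e' | e') hee
      · exact congrArg Sum.inl (Subtype.ext (congrArg (fun x => x.1) hee))
      · have hv : e.1 = e'.1.1 := congrArg (fun x => x.1) hee
        exact absurd (hv ▸ e'.1.2) (not_ends_subset_compl e.2)
      · have hv : e.1.1 = e'.1 := congrArg (fun x => x.1) hee
        exact absurd (hv ▸ e.1.2) (not_ends_subset_compl e'.2)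
      · exact congrArg Sum.inr (Subtype.ext (Subtype.ext (congrArg (fun x => x.1) hee)))
    · rintro ⟨e, he⟩
      rcases h.noCrossing e he with hT | hT
      · exact ⟨.inl ⟨e, hT⟩, rfl⟩
      · exact ⟨.inr ⟨⟨e, hT⟩, he⟩, rfl⟩
  ends_onE := by
    rintro (e | e)
    · change G.ends e.1 = (((G.induce T).ends e).map Sum.inl).map _
      rw [← map_val_ends_induce]
      cases (G.induce T).ends e with | _ x y => rfl
    · change G.ends e.1.1 = (((G.induce Tᶜ).ends e.1).map Sum.inr).map _
      rw [← map_val_ends_induce]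
      cases (G.induce Tᶜ).ends e.1 with | _ x y => rfl

/-- The vertices of `G` that are contracted into `I`. -/
def contractPreimage (F : Set G.E) (I : Set (G.contract F).V) : Set G.V :=
  {v | Quot.mk (G.AdjIn F) v ∈ I}

lemma noCrossing_contractPreimage (I : Set (G.contract F).V) :
    NoCrossing F (contractPreimage F I) := by
  intro e he
  obtain ⟨u, v, huv⟩ := G.exists_ends e
  have h : Quot.mk (G.AdjIn F) u = Quot.mk _ v := Quot.sound ⟨e, he, huv⟩
  rw [huv]
  by_cases hu : Quot.mk (G.AdjIn F) u ∈ I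
  · left
    intro w hw
    rcases Sym2.mem_iff.1 hw with rfl | rfl
    exacts [hu, show Quot.mk (G.AdjIn F) w ∈ I from h ▸ hu]
  · right
    intro w hw
    rcases Sym2.mem_iff.1 hw with rfl | rfl
    exacts [hu, fun hw => hu (h.symm ▸ hw)]

lemma splits_contractPreimage_iff {I : Set (G.contract F).V} :
    Splits F (contractPreimage F I) ↔ (G.contract F).IsStable I := by
  have key (e : G.E) : (∀ v ∈ (G.ends e).map (Quot.mk (G.AdjIn F)), v ∈ I) ↔
      ∀ v ∈ G.ends e, v ∈ contractPreimage F I := by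
    constructor
    · exact fun h v hv => h _ (Sym2.mem_map.2 ⟨v, hv, rfl⟩)
    · intro h v hv
      obtain ⟨w, hw, rfl⟩ := Sym2.mem_map.1 hv
      exact h w hw
  constructor
  · exact fun h e he => e.2 (h.mem e.1 ((key e.1).1 he))
  · refine fun h => ⟨fun e he => ?_, noCrossing_contractPreimage I⟩
    by_contra heF
    exact h ⟨e, heF⟩ ((key e).2 he)

lemma NoCrossing.contractPreimage_image (h : NoCrossing F T) :
    contractPreimage F (Quot.mk (G.AdjIn F) '' T) = T := by
  ext v
  constructor
  · rintro ⟨u, hu, huv⟩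
    by_contra hv
    exact (h.conn_induce hv (mk_adjIn_eq_iff.1 huv.symm)).1 hu
  · exact fun hv => ⟨v, hv, rfl⟩

lemma image_contractPreimage (I : Set (G.contract F).V) :
    Quot.mk (G.AdjIn F) '' contractPreimage F I = I :=
  Set.image_preimage_eq I fun q => Quot.exists_rep q

/-- Contraction commutes with restriction to the complement of a union of components. -/
def induceContract (F : Set G.E) (I : Set (G.contract F).V) :
    Iso ((G.induce (contractPreimage F I)ᶜ).contract (restrictEdges F (contractPreimage F I)ᶜ))
      ((G.contract F).induce Iᶜ) :=
  Iso.ofBijective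
    (Quot.lift (fun v => ⟨Quot.mk _ v.1, v.2⟩) fun u v h =>
      Subtype.ext (Quot.sound (adjIn_of_adjIn_induce h)))
    (fun e => ⟨⟨e.1.1, e.2⟩, fun v hv => by
      obtain ⟨w, hw, rfl⟩ := Sym2.mem_map.1 hv
      exact e.1.2 w hw⟩)
    (by
      constructor
      · rintro ⟨u⟩ ⟨v⟩ h
        have h' := mk_adjIn_eq_iff.1 (congrArg (fun x => x.1) h)
        exact mk_adjIn_eq_iff.2 ((noCrossing_contractPreimage I).conn_induce u.2 h').2
      · rintro ⟨⟨v⟩, hv⟩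
        exact ⟨Quot.mk _ ⟨v, hv⟩, rfl⟩)
    (by
      constructor
      · intro e e' h
        exact Subtype.ext (Subtype.ext (congrArg (fun x => x.1.1) h))
      · rintro ⟨⟨e, he⟩, h⟩
        exact ⟨⟨⟨e, fun v hv => h _ (Sym2.mem_map.2 ⟨v, hv, rfl⟩)⟩, he⟩, rfl⟩)
    (by
      intro e
      apply Sym2.map.injective Subtype.val_injective
      refine (map_val_ends_induce _ _ _).trans (Eq.trans ?_ (Sym2.map_map _).symm)
      change (G.ends e.1.1).map _ = (((G.induce (contractPreimage F I)ᶜ).ends e.1).map _).map _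
      rw [← map_val_ends_induce]
      cases (G.induce (contractPreimage F I)ᶜ).ends e.1 with | _ x y => rfl)

lemma numComponents_induce (I : Set (G.contract F).V) :
    (G.induce (contractPreimage F I)ᶜ).numComponents (restrictEdges F (contractPreimage F I)ᶜ) =
      Iᶜ.ncard :=
  Nat.card_congr (induceContract F I).onV

end Multigraph

namespace Multigraph

variable {R : Type*} [CommRing R] (χ : GraphClass →* R)

open Classical in
/-- The sum of `(-1) ^ c(S) χ(G_{V,S}) a(G/S)` over all flats `S` of `G`, where `c(S)` is the number
of components of `G_{V,S}`. -/
def flatSum (G : Multigraph) : R :=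
  ∑ S : Set G.E with G.IsFlat S, (-1) ^ G.numComponents S *
    (χ (G.spanning S).cls * ((G.contract S).numAcyclicOrientations : R))

open Classical in
lemma mul_flatSum_induce (G : Multigraph) (T : Set G.V) :
    χ (G.induce T).cls * flatSum χ (G.induce Tᶜ) =
      ∑ S : Set G.E with G.IsFlat S ∧ Splits S T, χ (G.spanning S).cls *
        ((-1) ^ (G.induce Tᶜ).numComponents (restrictEdges S Tᶜ) *
          (((G.induce Tᶜ).contract (restrictEdges S Tᶜ)).numAcyclicOrientations : R)) := by
  rw [flatSum, Finset.mul_sum]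
  refine Finset.sum_bij' (fun S _ => extendEdges T S) (fun S _ => restrictEdges S Tᶜ) ?_ ?_ ?_ ?_ ?_
  · intro S hS
    simp only [Finset.mem_filter, Finset.mem_univ, true_and] at hS ⊢
    exact ⟨(splits_extendEdges S).isFlat (by rwa [restrictEdges_extendEdges]),
      splits_extendEdges S⟩
  · intro S hS
    simp only [Finset.mem_filter, Finset.mem_univ, true_and] at hS ⊢
    exact hS.1.restrictEdges _
  · intro S _
    exact restrictEdges_extendEdges S
  · intro S hS
    simp only [Finset.mem_filter, Finset.mem_univ, true_and] at hS
    exact hS.2.extendEdges_restrictEdges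
  · intro S _
    have h := GraphClass.cls_eq (splits_extendEdges S).iso
    rw [restrictEdges_extendEdges, GraphClass.cls_disjUnion] at h
    rw [restrictEdges_extendEdges, ← h, map_mul]
    ring

open Classical in
lemma sum_splits (G : Multigraph) (S : Set G.E) :
    ∑ T : Set G.V with Splits S T,
      (-1 : R) ^ (G.induce Tᶜ).numComponents (restrictEdges S Tᶜ) *
        (((G.induce Tᶜ).contract (restrictEdges S Tᶜ)).numAcyclicOrientations : R) =
      if IsEmpty G.V then 1 else 0 := by
  have hV : IsEmpty (G.contract S).V ↔ IsEmpty G.V :=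
    ⟨fun h => ⟨fun v => h.elim (Quot.mk _ v)⟩, fun h => ⟨Quot.ind fun v => h.elim v⟩⟩
  rw [← if_congr hV rfl rfl, ← sum_stable_numAcyclicOrientations R (G.contract S)]
  symm
  refine Finset.sum_bij' (fun I _ => contractPreimage S I)
    (fun T _ => (Quot.mk (G.AdjIn S) '' T : Set (Quot (G.AdjIn S)))) ?_ ?_ ?_ ?_ ?_
  · intro I hI
    simp only [Finset.mem_filter, Finset.mem_univ, true_and] at hI ⊢
    exact splits_contractPreimage_iff.2 hI
  · intro T hT
    simp only [Finset.mem_filter, Finset.mem_univ, true_and] at hT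
    refine Finset.mem_filter.2 ⟨Finset.mem_univ _, splits_contractPreimage_iff.1 ?_⟩
    exact hT.noCrossing.contractPreimage_image.symm ▸ hT
  · intro I _
    exact image_contractPreimage I
  · intro T hT
    simp only [Finset.mem_filter, Finset.mem_univ, true_and] at hT
    exact hT.noCrossing.contractPreimage_image
  · intro I _
    rw [numComponents_induce, numAcyclicOrientations_eq (induceContract S I)]

open Classical in
/-- `flatSum χ` is a right inverse of `χ` under convolution. -/
theorem sum_mul_flatSum (G : Multigraph) :
    ∑ T : Set G.V, χ (G.induce T).cls * flatSum χ (G.induce Tᶜ) =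
      if IsEmpty G.V then 1 else 0 := by
  simp_rw [mul_flatSum_induce, Finset.sum_filter]
  rw [Finset.sum_comm]
  have h (S : Set G.E) : (∑ T : Set G.V, if G.IsFlat S ∧ Splits S T then χ (G.spanning S).cls *
        ((-1) ^ (G.induce Tᶜ).numComponents (restrictEdges S Tᶜ) *
          (((G.induce Tᶜ).contract (restrictEdges S Tᶜ)).numAcyclicOrientations : R)) else 0) =
      if G.IsFlat S ∧ IsEmpty G.V then χ (G.spanning S).cls else 0 := by
    by_cases hS : G.IsFlat S
    · simp only [hS, true_and]
      rw [← Finset.sum_filter, ← Finset.mul_sum, sum_splits, mul_ite, mul_one, mul_zero]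
    · simp [hS]
  rw [Finset.sum_congr rfl fun S _ => h S]
  split_ifs with hV
  · have hE : IsEmpty G.E := ⟨fun e => isEmptyElim (G.ends e).out.1⟩
    have (S : Set G.E) : IsEmpty (G.spanning S).V := hV
    rw [Fintype.sum_eq_single ∅ fun S hS => absurd (Set.eq_empty_of_isEmpty S) hS,
      if_pos ⟨fun e => isEmptyElim e, hV⟩, GraphClass.cls_eq_one, map_one]
  · simp [hV]

lemma isEmpty_induce_empty (G : Multigraph) : IsEmpty (G.induce ∅).V := ⟨fun v => v.2⟩

lemma splits_empty {G : Multigraph} (S : Set G.E) : Splits S ∅ where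
  mem _ h := absurd (fun _ _ hv => hv) (not_ends_subset_compl h)
  noCrossing _ _ := .inr fun _ _ hv => hv

open Classical in
lemma flatSum_induce_compl_empty (G : Multigraph) : flatSum χ (G.induce ∅ᶜ) = flatSum χ G := by
  have : IsEmpty (G.induce ∅).V := G.isEmpty_induce_empty
  have h := mul_flatSum_induce χ G ∅
  rw [GraphClass.cls_eq_one, map_one, one_mul] at h
  rw [h, flatSum]
  refine Finset.sum_congr (by simp [splits_empty]) fun S _ => ?_
  have h1 := numComponents_induce (F := S) ∅
  have h2 := numAcyclicOrientations_eq (induceContract S ∅)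
  have h3 : contractPreimage S ∅ = ∅ := rfl
  rw [h3] at h1 h2
  rw [h1, h2, Set.compl_empty, Set.ncard_univ, numAcyclicOrientations_eq (induceUniv _)]
  change _ * ((-1) ^ G.numComponents S * _) = _
  ring

lemma eq_of_sum_eq {ι : Type*} [Fintype ι] {f g : ι → R} (a : ι) (h : ∑ i, f i = ∑ i, g i)
    (hne : ∀ i, i ≠ a → f i = g i) : f a = g a := by
  classical
  rw [← Finset.add_sum_erase _ _ (Finset.mem_univ a),
    ← Finset.add_sum_erase _ g (Finset.mem_univ a),
    Finset.sum_congr rfl fun i hi => hne i (Finset.ne_of_mem_erase hi)] at h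
  exact add_right_cancel h

lemma card_induce_compl_lt {G : Multigraph} {T : Set G.V} (hT : T ≠ ∅) :
    Nat.card (G.induce Tᶜ).V < Nat.card G.V := by
  obtain ⟨v, hv⟩ := Set.nonempty_iff_ne_empty.2 hT
  exact Finite.card_subtype_lt (x := v) fun h => h hv

lemma card_induce_le {G : Multigraph} (T : Set G.V) :
    Nat.card (G.induce T).V ≤ Nat.card G.V :=
  Finite.card_subtype_le _

lemma flatSum_eq {G H : Multigraph} (f : Iso G H) : flatSum χ G = flatSum χ H := by
  classical
  induction hn : Nat.card H.V using Nat.strong_induction_on generalizing G H with | _ n ih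
  have hG := sum_mul_flatSum χ G
  rw [← (Equiv.Set.congr f.onV).symm.sum_comp] at hG
  have h := eq_of_sum_eq (∅ : Set H.V)
    (f := fun T => χ (G.induce (f.onV ⁻¹' T)).cls * flatSum χ (G.induce (f.onV ⁻¹' T)ᶜ))
    (g := fun T => χ (H.induce T).cls * flatSum χ (H.induce Tᶜ)) ?_ ?_
  · have h1 : IsEmpty (G.induce ∅).V := G.isEmpty_induce_empty
    have h2 : IsEmpty (H.induce ∅).V := H.isEmpty_induce_empty
    simp only [Set.preimage_empty] at h
    rwa [GraphClass.cls_eq_one, GraphClass.cls_eq_one, map_one, one_mul, one_mul,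
      flatSum_induce_compl_empty, flatSum_induce_compl_empty] at h
  · rw [sum_mul_flatSum, ← if_congr f.onV.isEmpty_congr rfl rfl, ← hG]
    refine Finset.sum_congr rfl fun T _ => ?_
    have h : ((Equiv.Set.congr f.onV).symm T : Set G.V) = f.onV ⁻¹' T :=
      f.onV.symm.image_eq_preimage_symm T
    rw [h]
  · intro T hT
    rw [GraphClass.cls_eq (f.induce T), ← Set.preimage_compl,
      ih _ (hn ▸ card_induce_compl_lt hT) (f.induce Tᶜ) rfl]

lemma flatSum_of_isEmpty (G : Multigraph) [hG : IsEmpty G.V] : flatSum χ G = 1 := by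
  have h := sum_mul_flatSum χ G
  have : IsEmpty (G.induce ∅).V := G.isEmpty_induce_empty
  rwa [if_pos hG, Fintype.sum_eq_single ∅ fun S hS => absurd (Set.eq_empty_of_isEmpty S) hS,
    GraphClass.cls_eq_one, map_one, one_mul, flatSum_induce_compl_empty] at h

/-- Pairs of vertex sets are the same as vertex sets of the disjoint union. -/
def setDisjUnionEquiv (G H : Multigraph) : Set G.V × Set H.V ≃ Set (G.disjUnion H).V where
  toFun p := {v | Sum.elim (· ∈ p.1) (· ∈ p.2) v}
  invFun T := (Sum.inl ⁻¹' T, Sum.inr ⁻¹' T)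
  left_inv _ := rfl
  right_inv T := by ext (v | v) <;> rfl

lemma setDisjUnionEquiv_compl {G H : Multigraph} (S : Set G.V) (T : Set H.V) :
    (setDisjUnionEquiv G H (S, T))ᶜ = setDisjUnionEquiv G H (Sᶜ, Tᶜ) := by
  ext (v | v) <;> rfl

lemma flatSum_disjUnion (G H : Multigraph) :
    flatSum χ (G.disjUnion H) = flatSum χ G * flatSum χ H := by
  classical
  induction hn : Nat.card G.V + Nat.card H.V using Nat.strong_induction_on generalizing G H
    with | _ n ih
  have h := eq_of_sum_eq ((∅, ∅) : Set G.V × Set H.V)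
    (f := fun p => χ (G.induce p.1).cls * χ (H.induce p.2).cls *
      flatSum χ ((G.induce p.1ᶜ).disjUnion (H.induce p.2ᶜ)))
    (g := fun p => χ (G.induce p.1).cls * χ (H.induce p.2).cls *
      (flatSum χ (G.induce p.1ᶜ) * flatSum χ (H.induce p.2ᶜ))) ?_ ?_
  · have h1 : IsEmpty (G.induce ∅).V := G.isEmpty_induce_empty
    have h2 : IsEmpty (H.induce ∅).V := H.isEmpty_induce_empty
    simp only [GraphClass.cls_eq_one (G.induce ∅), GraphClass.cls_eq_one (H.induce ∅), map_one,
      one_mul, flatSum_induce_compl_empty] at h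
    rw [← h, Set.compl_empty, Set.compl_empty]
    exact (flatSum_eq χ ((induceUniv G).disjUnion (induceUniv H))).symm
  · have hGH := sum_mul_flatSum χ (G.disjUnion H)
    rw [← (setDisjUnionEquiv G H).sum_comp] at hGH
    have hE : IsEmpty (G.disjUnion H).V ↔ IsEmpty G.V ∧ IsEmpty H.V :=
      isEmpty_sum (α := G.V) (β := H.V)
    have hl : ∑ p : Set G.V × Set H.V, χ (G.induce p.1).cls * χ (H.induce p.2).cls *
        (flatSum χ (G.induce p.1ᶜ) * flatSum χ (H.induce p.2ᶜ)) =
        (if IsEmpty G.V then 1 else 0) * if IsEmpty H.V then 1 else 0 := by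
      rw [← sum_mul_flatSum χ G, ← sum_mul_flatSum χ H, Finset.sum_mul_sum, Fintype.sum_prod_type]
      refine Finset.sum_congr rfl fun S _ => Finset.sum_congr rfl fun T _ => ?_
      ring
    have hr : (if IsEmpty G.V then 1 else 0) * (if IsEmpty H.V then 1 else 0) =
        if IsEmpty (G.disjUnion H).V then (1 : R) else 0 := by
      rw [if_congr hE rfl rfl, ite_and]
      split_ifs <;> simp
    rw [hl, hr, ← hGH]
    refine Finset.sum_congr rfl fun p _ => ?_
    rw [← map_mul, ← GraphClass.cls_disjUnion, GraphClass.cls_eq (induceDisjUnion G H p.1 p.2),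
      setDisjUnionEquiv_compl, flatSum_eq χ (induceDisjUnion G H p.1ᶜ p.2ᶜ)]
    rfl
  · rintro ⟨S, T⟩ hST
    refine congrArg _ (ih _ ?_ _ _ rfl)
    rw [← hn]
    by_cases hS : S = ∅
    · have hT : T ≠ ∅ := fun hT => hST (by rw [hS, hT])
      exact add_lt_add_of_le_of_lt (card_induce_le _) (card_induce_compl_lt hT)
    · exact add_lt_add_of_lt_of_le (card_induce_compl_lt hS) (card_induce_le _)

/-- `flatSum χ` as a multiplicative function of isomorphism classes. -/
def flatSumHom : GraphClass →* R where
  toFun := Quotient.lift (flatSum χ) fun _ _ ⟨f⟩ => flatSum_eq χ f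
  map_one' := flatSum_of_isEmpty χ empty
  map_mul' a b := by
    induction a using GraphClass.ind with | _ G
    induction b using GraphClass.ind with | _ H
    exact flatSum_disjUnion χ G H

open Classical in
lemma flatSum_eq_rk {F : Type*} [Field F] (χ : GraphClass →* F) (G : Multigraph) :
    flatSum χ G = ∑ S : Set G.E with G.IsFlat S,
      (-1 : F) ^ ((Nat.card G.V : ℤ) - (G.rk S : ℤ)) *
        (χ (G.spanning S).cls * ((G.contract S).numAcyclicOrientations : F)) := by
  refine Finset.sum_congr rfl fun S _ => ?_
  rw [← rk_add_numComponents S, Nat.cast_add, add_sub_cancel_left, zpow_natCast]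

end Multigraph

namespace GraphAlgebra

variable {F : Type*} [Field F]

lemma convMul_ofGraph (φ ψ : WithConv (GraphAlgebra F →ₐ[F] F)) (G : Multigraph) :
    (φ * ψ) (ofGraph F G) =
      ∑ T : Set G.V, φ (ofGraph F (G.induce T)) * ψ (ofGraph F (G.induce Tᶜ)) := by
  rw [AlgHom.convMul_apply]
  change Algebra.TensorProduct.lift _ _ _ (comulHom F (ofGraph F G)) = _
  rw [comulHom_ofGraph, map_sum]
  rfl

open Classical in
lemma convOne_ofGraph (G : Multigraph) :
    (1 : WithConv (GraphAlgebra F →ₐ[F] F)) (ofGraph F G) = if IsEmpty G.V then 1 else 0 :=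
  counitHom_ofGraph F G

lemma convMul_comm (φ ψ : WithConv (GraphAlgebra F →ₐ[F] F)) : φ * ψ = ψ * φ := by
  refine WithConv.ext (algHom_ext fun G => ?_)
  rw [convMul_ofGraph, convMul_ofGraph, 
    ← Equiv.sum_comp (compl_involutive.toPerm (compl : Set G.V → Set G.V))]
  refine Finset.sum_congr rfl fun T _ => ?_
  rw [Function.Involutive.coe_toPerm, compl_compl, mul_comm]

end GraphAlgebra

end

open Classical in
/-- `Ω` is a family of finite graphs, closed under isomorphism. A character is a (unital) algebra
homomorphism from the graph algebra to `F`; `*` and `1` are the convolution product of characters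
and its identity, the counit. -/
theorem proposition3p2 (F : Type*) [Field F] (Ω : Set GraphClass) :
    ((Ω.Nonempty ∧ ∀ G H : Multigraph, (G.disjUnion H).cls ∈ Ω ↔ G.cls ∈ Ω ∧ H.cls ∈ Ω) ↔
      ∃ ψ : GraphAlgebra F →ₐ[F] F, ∀ G : Multigraph,
        ψ (GraphAlgebra.ofGraph F G) = if G.cls ∈ Ω then 1 else 0) ∧
    ∀ ψ : WithConv (GraphAlgebra F →ₐ[F] F),
      (∀ G : Multigraph, ψ (GraphAlgebra.ofGraph F G) = if G.cls ∈ Ω then 1 else 0) →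
      ∃ φ : WithConv (GraphAlgebra F →ₐ[F] F), ψ * φ = 1 ∧ φ * ψ = 1 ∧
        ∀ G : Multigraph, φ (GraphAlgebra.ofGraph F G) =
          ∑ S : Set G.E with G.IsFlat S ∧ (G.spanning S).cls ∈ Ω,
            (-1 : F) ^ ((Nat.card G.V : ℤ) - (G.rk S : ℤ)) *
              ((G.contract S).numAcyclicOrientations : F) := by
  refine ⟨⟨?_, ?_⟩, fun ψ hψ => ?_⟩
  · rintro ⟨⟨c, hc⟩, h⟩
    have h1 : (1 : GraphClass) ∈ Ω := by
      induction c using GraphClass.ind with | _ G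
      refine ((h G Multigraph.empty).1 ?_).2
      rwa [GraphClass.cls_disjUnion, GraphClass.cls_empty, mul_one]
    let χ : GraphClass →* F :=
      { toFun := fun c => if c ∈ Ω then 1 else 0
        map_one' := if_pos h1
        map_mul' := fun a b => by
          induction a using GraphClass.ind with | _ G
          induction b using GraphClass.ind with | _ H
          have := h G H
          rw [GraphClass.cls_disjUnion] at this
          rw [if_congr this rfl rfl, ite_and]
          split_ifs <;> simp }
    exact ⟨GraphAlgebra.lift F χ, fun G => GraphAlgebra.lift_ofGraph F χ G⟩
  · rintro ⟨ψ, hψ⟩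
    refine ⟨⟨Multigraph.empty.cls, ?_⟩, fun G H => ?_⟩
    · have h := hψ Multigraph.empty
      rw [GraphAlgebra.ofGraph_of_isEmpty, map_one] at h
      by_contra hne
      rw [if_neg hne] at h
      exact one_ne_zero h
    · have h := hψ (G.disjUnion H)
      rw [GraphAlgebra.ofGraph_disjUnion, map_mul, hψ, hψ] at h
      by_cases hG : G.cls ∈ Ω <;> by_cases hH : H.cls ∈ Ω <;>
        by_cases hGH : (G.disjUnion H).cls ∈ Ω <;> simp [hG, hH, hGH] at h ⊢
  · let χ : GraphClass →* F := (ψ.ofConv : GraphAlgebra F →* F).comp (GraphAlgebra.ofClass F)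
    have hχ (G : Multigraph) : χ G.cls = if G.cls ∈ Ω then 1 else 0 := hψ G
    let φ : WithConv (GraphAlgebra F →ₐ[F] F) :=
      .toConv (GraphAlgebra.lift F (Multigraph.flatSumHom χ))
    have hφ (G : Multigraph) : φ (GraphAlgebra.ofGraph F G) = Multigraph.flatSum χ G :=
      GraphAlgebra.lift_ofGraph F _ G
    have hinv : ψ * φ = 1 := by
      refine WithConv.ext (GraphAlgebra.algHom_ext fun G => ?_)
      rw [GraphAlgebra.convMul_ofGraph, GraphAlgebra.convOne_ofGraph, 
        ← Multigraph.sum_mul_flatSum χ G]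
      exact Finset.sum_congr rfl fun T _ => congrArg _ (hφ _)
    refine ⟨φ, hinv, (GraphAlgebra.convMul_comm φ ψ).trans hinv, fun G => ?_⟩
    rw [hφ, Multigraph.flatSum_eq_rk, Finset.sum_filter, Finset.sum_filter]
    refine Finset.sum_congr rfl fun S _ => ?_
    rw [hχ, ite_and]
    split_ifs <;> simp
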